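/- A Lehmer number (a number with the Lehmer property) is a composite positive integer $m$ such that $\varphi(m)\mid m-1$, where $\varphi$ is Euler's totient function. Let $\nu_2$ denote the $2$-adic valuation. Let $L\ge 1$ be a real number and let $$B(L)=\left\{\,b_{g,n}=\frac{g^{n}-1}{g-1}\ :\ g,n\in\mathbb{N},\ g\ge 2,\ n\ge 1,\ 1\le \nu_2(g+1)\le L\right\}$$ (so the bases $g$ that occur are odd). If integers $g\ge 2$ and $n\ge 1$ with $1\le \nu_2(g+1)\le L$ are such that $b_{g,n}=\frac{g^{n}-1}{g-1}$ has the Lehmer property, then $$g<2^{2^{L-1}}.$$ Moreover, $B(L)$ contains only finitely many Lehmer numbers. -/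

import Mathlib

/-- `m` has the Lehmer property (is a Lehmer number): `m` is composite and `φ(m) ∣ m - 1`. -/
def IsLehmer (m : ℕ) : Prop :=
  1 < m ∧ ¬ m.Prime ∧ Nat.totient m ∣ m - 1

/-- The repunit `(g ^ n - 1) / (g - 1)`; used only for `g ≥ 2`, where the division is exact. -/
def repunit (g n : ℕ) : ℕ :=
  (g ^ n - 1) / (g - 1)

/-- The set `B(L)` of repunits `(g ^ n - 1) / (g - 1)` with `g ≥ 2`, `n ≥ 1` and
`1 ≤ ν₂(g + 1) ≤ L` (so that `g` is odd). -/
def oddRepunits (L : ℝ) : Set ℕ :=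
  {b | ∃ g n : ℕ, 2 ≤ g ∧ 1 ≤ n ∧ 1 ≤ padicValNat 2 (g + 1) ∧
    (padicValNat 2 (g + 1) : ℝ) ≤ L ∧ b = repunit g n}

/-! Let `m = (g^n - 1)/(g - 1)` be Lehmer with `k` prime factors, so `m = K φ(m) + 1` with `K ≥ 2`.
Two facts bound the base. A majorization argument comparing the prime factors with the Fermat
numbers gives `m < 2^(2^k)`. On the other side `m` is odd and squarefree, so `2^k ∣ φ(m) ∣ m - 1 = g
(g^(n-1) - 1)/(g - 1)`, and lifting the exponent gives `2^k ≤ 2^(v-1) (n-1)` with `v = ν₂(g + 1)`.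
Since `g^(n-1) < m`, taking `(n-1)`-th roots yields `g < 2^(2^(v-1))`.

For a fixed base it suffices to bound `k`. Every prime `p ∣ m` has an order of `g` that is divisible
by some prime `q ∣ n`, and at most `g q` primes `p` belong to a given `q`. Hence it is enough to
bound the prime factors of `n`. Suppose they leave a large gap above `B`. The boundedly many `p`
belonging to some `q ≤ B` contribute a product of factors `p/(p-1)` that stays a fixed distance from
every integer `≥ 2`, while all other `p` contribute a factor close to 1. This contradicts `m/φ(m) =
K + 1/φ(m)`. So gaps are bounded, and since the number of prime factors of `n` is bounded as well
(`two_pow_card_primeFactors_le`), so are the primes themselves. -/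

/-! ### Majorization and a doubly exponential bound. -/

theorem sum_mul_nonneg_of_antitone_of_partialSums {w d : ℕ → ℝ} {r : ℕ}
    (hw : ∀ i < r, 0 ≤ w i) (hanti : ∀ i, i + 1 < r → w (i + 1) ≤ w i)
    (hd : ∀ j ≤ r, 0 ≤ ∑ i ∈ Finset.range j, d i) :
    0 ≤ ∑ i ∈ Finset.range r, w i * d i := by
  have key : ∀ j, j + 1 ≤ r →
      w j * ∑ i ∈ Finset.range (j + 1), d i ≤ ∑ i ∈ Finset.range (j + 1), w i * d i := by
    intro j
    induction j with
    | zero => intro _; simp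
    | succ j ih =>
      intro hj
      rw [Finset.sum_range_succ, Finset.sum_range_succ (fun i => w i * d i), mul_add]
      have h1 := ih (by omega)
      have h2 := mul_le_mul_of_nonneg_right (hanti j (by omega)) (hd (j + 1) (by omega))
      linarith
  rcases r with _ | r
  · simp
  · exact (mul_nonneg (hw r (by omega)) (hd (r + 1) le_rfl)).trans (key r le_rfl)

/-- Tangent-line inequality: as a function of `s = log x`, `log (1 - exp (-s))` is concave with
derivative `1/(x - 1)`. -/
theorem log_one_sub_inv_sub_le {x y : ℝ} (hx : 1 < x) (hy : 1 < y) :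
    Real.log (1 - 1 / y) - Real.log (1 - 1 / x) ≤ (x - 1)⁻¹ * (Real.log y - Real.log x) := by
  have hx0 : 0 < x := by linarith
  have hy0 : 0 < y := by linarith
  have h1 : 0 < 1 - 1 / x := by
    rw [sub_pos, div_lt_one hx0]; exact hx
  have h2 : 0 < 1 - 1 / y := by
    rw [sub_pos, div_lt_one hy0]; exact hy
  rw [← Real.log_div h2.ne' h1.ne', ← Real.log_div hy0.ne' hx0.ne']
  have hxm : 0 < x - 1 := by linarith
  calc Real.log ((1 - 1 / y) / (1 - 1 / x)) ≤ (1 - 1 / y) / (1 - 1 / x) - 1 :=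
        Real.log_le_sub_one_of_pos (by positivity)
    _ = (x - 1)⁻¹ * (1 - (y / x)⁻¹) := by
        have : x - 1 ≠ 0 := hxm.ne'
        field_simp
        ring
    _ ≤ _ := by
        gcongr
        exact Real.one_sub_inv_le_log_of_pos (by positivity)

/-- Sum the tangent-line inequalities at the `x i`. The slopes `1/(x i - 1)` decrease, so summation
by parts reduces the claim to the comparison of partial products. -/
theorem prod_one_sub_inv_le_of_prod_le {x y : ℕ → ℝ} {r : ℕ} (hx : ∀ i < r, 1 < x i)
    (hy : ∀ i < r, 1 < y i) (hmono : ∀ i, i + 1 < r → x i ≤ x (i + 1))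
    (hle : ∀ j ≤ r, ∏ i ∈ Finset.range j, y i ≤ ∏ i ∈ Finset.range j, x i) :
    ∏ i ∈ Finset.range r, (1 - 1 / y i) ≤ ∏ i ∈ Finset.range r, (1 - 1 / x i) := by
  have pos : ∀ {t : ℝ}, 1 < t → 0 < 1 - 1 / t := fun {t} ht => by
    rw [sub_pos, div_lt_one (by linarith)]; exact ht
  have hpx : ∀ i ∈ Finset.range r, 0 < 1 - 1 / x i := fun i hi => pos (hx i (Finset.mem_range.1 hi))
  have hpy : ∀ i ∈ Finset.range r, 0 < 1 - 1 / y i := fun i hi => pos (hy i (Finset.mem_range.1 hi))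
  rw [← Real.log_le_log_iff (Finset.prod_pos hpy) (Finset.prod_pos hpx),
    Real.log_prod (fun i hi => (hpy i hi).ne'), Real.log_prod (fun i hi => (hpx i hi).ne'),
    ← sub_nonneg, ← Finset.sum_sub_distrib]
  have habel : 0 ≤ ∑ i ∈ Finset.range r, (x i - 1)⁻¹ * (Real.log (x i) - Real.log (y i)) := by
    refine sum_mul_nonneg_of_antitone_of_partialSums (fun i hi => ?_) (fun i hi => ?_)
      (fun j hj => ?_)
    · have := hx i hi
      exact inv_nonneg.2 (by linarith)
    · have := hx i (by omega)
      have := hmono i hi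
      exact inv_anti₀ (by linarith) (by linarith)
    · have hx' : ∀ i ∈ Finset.range j, 0 < x i := fun i hi => by
        have := hx i (by have := Finset.mem_range.1 hi; omega)
        linarith
      have hy' : ∀ i ∈ Finset.range j, 0 < y i := fun i hi => by
        have := hy i (by have := Finset.mem_range.1 hi; omega)
        linarith
      rw [Finset.sum_sub_distrib, ← Real.log_prod (fun i hi => (hx' i hi).ne'),
        ← Real.log_prod (fun i hi => (hy' i hi).ne'), sub_nonneg]
      exact Real.log_le_log (Finset.prod_pos hy') (hle j hj)
  refine habel.trans (Finset.sum_le_sum fun i hi => ?_)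
  have := log_one_sub_inv_sub_le (hx i (Finset.mem_range.1 hi)) (hy i (Finset.mem_range.1 hi))
  linarith

/-- The factors `(a+1)^(2^i) + 1` form the extremal sequence; for `a = 1` they are the Fermat
numbers. -/
theorem mul_prod_pow_two_pow_add_one (a : ℝ) (j : ℕ) :
    a * ∏ i ∈ Finset.range j, ((a + 1) ^ 2 ^ i + 1) = (a + 1) ^ 2 ^ j - 1 := by
  induction j with
  | zero => simp
  | succ j ih => rw [Finset.prod_range_succ, ← mul_assoc, ih, pow_succ 2 j, pow_mul]; ring

theorem prod_one_sub_inv_pow_two_pow_add_one {a : ℝ} (ha : 0 < a) (r : ℕ) :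
    a / (a + 1) < ∏ i ∈ Finset.range r, (1 - 1 / ((a + 1) ^ 2 ^ i + 1)) := by
  have key : (a + 1) * ((a + 1) ^ 2 ^ r - 1) *
      ∏ i ∈ Finset.range r, (1 - 1 / ((a + 1) ^ 2 ^ i + 1)) = a * (a + 1) ^ 2 ^ r := by
    induction r with
    | zero => simp; ring
    | succ r ih =>
      rw [Finset.prod_range_succ]
      have h : (a + 1) ^ 2 ^ (r + 1) = (a + 1) ^ 2 ^ r * (a + 1) ^ 2 ^ r := by
        rw [pow_succ 2 r, pow_mul, sq]
      rw [h]
      set t := (a + 1) ^ 2 ^ r with ht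
      set Q := ∏ i ∈ Finset.range r, (1 - 1 / ((a + 1) ^ 2 ^ i + 1))
      have ht0 : 0 < t := by positivity
      have h1 : (t + 1) * (1 - 1 / (t + 1)) = t := by field_simp; ring
      calc (a + 1) * (t * t - 1) * (Q * (1 - 1 / (t + 1)))
          = ((a + 1) * (t - 1) * Q) * ((t + 1) * (1 - 1 / (t + 1))) := by ring
        _ = _ := by rw [ih, h1]; ring
  have ht : 1 < (a + 1) ^ 2 ^ r := one_lt_pow₀ (by linarith) (by positivity)
  set t := (a + 1) ^ 2 ^ r
  set Q := ∏ i ∈ Finset.range r, (1 - 1 / ((a + 1) ^ 2 ^ i + 1))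
  rw [div_lt_iff₀ (by linarith)]
  have hd : 0 < t - 1 := by linarith
  refine lt_of_mul_lt_mul_right (?_ : a * (t - 1) < Q * (a + 1) * (t - 1)) hd.le
  linarith

/-- If `a / b` lies between two consecutive partial products of `∏ (1 - 1 / x i)`, then the `x i`
are doubly exponentially bounded. -/
theorem mul_prod_lt_pow_two_pow (r : ℕ) : ∀ (x : ℕ → ℕ) (a b : ℕ), 0 < r → 0 < a →
    (∀ i < r, 2 ≤ x i) → (∀ i, i + 1 < r → x i ≤ x (i + 1)) →
    (∀ j < r, a * ∏ i ∈ Finset.range j, x i < b * ∏ i ∈ Finset.range j, (x i - 1)) →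
    b * ∏ i ∈ Finset.range r, (x i - 1) ≤ a * ∏ i ∈ Finset.range r, x i →
    a * ∏ i ∈ Finset.range r, x i < (a + 1) ^ 2 ^ r := by
  induction r using Nat.strong_induction_on with
  | _ r ih =>
  intro x a b hr ha hx hmono hlt hle
  -- If a proper partial product already obeys the bound, the induction hypothesis applies to the
  -- remaining factors, with that product absorbed into `a` and `b`.
  by_cases hj : ∃ j, 0 < j ∧ j < r ∧ a * ∏ i ∈ Finset.range j, x i < (a + 1) ^ 2 ^ j
  · obtain ⟨j, hj0, hjr, hj⟩ := hj
    obtain ⟨s, rfl⟩ := Nat.exists_eq_add_of_le hjr.le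
    have h := ih s (by omega) (fun i => x (j + i)) (a * ∏ i ∈ Finset.range j, x i)
      (b * ∏ i ∈ Finset.range j, (x i - 1)) (by omega)
      (Nat.mul_pos ha (Finset.prod_pos fun i hi => by
        have := hx i (by have := Finset.mem_range.1 hi; omega)
        omega))
      (fun i hi => hx _ (by omega)) (fun i hi => hmono _ (by omega))
      (fun t ht => by
        have := hlt (j + t) (by omega)
        rw [Finset.prod_range_add, Finset.prod_range_add] at this
        simpa only [mul_assoc] using this)
      (by
        rw [Finset.prod_range_add, Finset.prod_range_add] at hle
        simpa only [mul_assoc] using hle)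
    rw [Finset.prod_range_add, ← mul_assoc]
    refine h.trans_le ?_
    rw [pow_add 2 j s, pow_mul]
    exact Nat.pow_le_pow_left hj _
  -- Otherwise every partial product dominates the extremal one, and majorization gives `∏ (1 - 1/x
  -- i) > a/(a+1) ≥ a/b`, against the last hypothesis.
  · by_contra hcon
    have hall : ∀ j, j ≤ r → (a + 1) ^ 2 ^ j - 1 ≤ a * ∏ i ∈ Finset.range j, x i := by
      intro j hjr
      rcases Nat.eq_zero_or_pos j with rfl | hj0
      · simp
      rcases hjr.lt_or_eq with h | rfl
      · by_contra h'
        exact hj ⟨j, hj0, h, by omega⟩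
      · omega
    have ha' : (0 : ℝ) < a := by exact_mod_cast ha
    have hx' : ∀ i < r, (1 : ℝ) < x i := fun i hi => by exact_mod_cast hx i hi
    have hcmp := prod_one_sub_inv_le_of_prod_le (x := fun i => (x i : ℝ))
      (y := fun i => ((a : ℝ) + 1) ^ 2 ^ i + 1) (r := r) hx'
      (fun i _ => by have : (0 : ℝ) < ((a : ℝ) + 1) ^ 2 ^ i := by positivity
                     simpa using this)
      (fun i hi => by exact_mod_cast hmono i hi)
      (fun j hjr => by
        refine le_of_mul_le_mul_left ?_ ha'
        rw [mul_prod_pow_two_pow_add_one]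
        have := hall j hjr
        rw [tsub_le_iff_right] at this
        rw [sub_le_iff_le_add]
        exact_mod_cast this)
    have hgt := (prod_one_sub_inv_pow_two_pow_add_one ha' r).trans_le hcmp
    have hab : a < b := by simpa using hlt 0 hr
    have hb' : (0 : ℝ) < b := by exact_mod_cast ha.trans hab
    have h1 : (a : ℝ) / b ≤ a / (a + 1) := by
      have : (a : ℝ) + 1 ≤ b := by exact_mod_cast hab
      gcongr
    have h2 : (b : ℝ) * ∏ i ∈ Finset.range r, ((x i : ℝ) - 1) ≤ a * ∏ i ∈ Finset.range r, (x i : ℝ) := by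
      have : ∏ i ∈ Finset.range r, ((x i : ℝ) - 1) = ((∏ i ∈ Finset.range r, (x i - 1) : ℕ) : ℝ) := by
        rw [Nat.cast_prod]
        refine Finset.prod_congr rfl fun i hi => ?_
        rw [Nat.cast_sub (by have := hx i (Finset.mem_range.1 hi); omega), Nat.cast_one]
      rw [this]
      exact_mod_cast hle
    have hP : (0 : ℝ) < ∏ i ∈ Finset.range r, (x i : ℝ) := Finset.prod_pos fun i hi => by
      have := hx' i (Finset.mem_range.1 hi)
      linarith
    have h3 : ∏ i ∈ Finset.range r, (1 - 1 / (x i : ℝ)) =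
        (∏ i ∈ Finset.range r, ((x i : ℝ) - 1)) / ∏ i ∈ Finset.range r, (x i : ℝ) := by
      rw [← Finset.prod_div_distrib]
      refine Finset.prod_congr rfl fun i hi => ?_
      have := hx' i (Finset.mem_range.1 hi)
      have : (x i : ℝ) ≠ 0 := by positivity
      field_simp
    rw [h3] at hgt
    have h4 : (∏ i ∈ Finset.range r, ((x i : ℝ) - 1)) / ∏ i ∈ Finset.range r, (x i : ℝ) ≤ a / b := by
      rw [div_le_div_iff₀ hP hb']
      linarith
    linarith

/-! ### General properties of Lehmer numbers. -/

namespace IsLehmer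

variable {m : ℕ}

theorem two_lt (hm : IsLehmer m) : 2 < m := by
  obtain ⟨h1, h2, -⟩ := hm
  rcases Nat.lt_or_ge 2 m with h | h
  · exact h
  · obtain rfl : m = 2 := by omega
    exact absurd Nat.prime_two h2

theorem odd (hm : IsLehmer m) : Odd m := by
  have h := ((Nat.totient_even hm.two_lt).two_dvd).trans hm.2.2
  have := hm.1
  rw [Nat.odd_iff]
  omega

theorem eq_one_of_dvd_of_dvd_totient (hm : IsLehmer m) {d : ℕ} (h1 : d ∣ m)
    (h2 : d ∣ m.totient) : d = 1 := by
  have h3 := h2.trans hm.2.2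
  have h4 := (Nat.dvd_sub_iff_right (by have := hm.1; omega : 1 ≤ m) h1).1 h3
  exact Nat.dvd_one.1 h4

theorem squarefree (hm : IsLehmer m) : Squarefree m := by
  rw [Nat.squarefree_iff_prime_squarefree]
  intro p hp hpm
  have h1 : p * (p - 1) ∣ m.totient := by
    have := Nat.totient_dvd_of_dvd hpm
    rwa [← sq, Nat.totient_prime_pow_succ hp, pow_one] at this
  exact hp.one_lt.ne' (hm.eq_one_of_dvd_of_dvd_totient ((Dvd.intro _ rfl).trans hpm)
    ((Dvd.intro _ rfl).trans h1))

theorem prod_primeFactors (hm : IsLehmer m) : ∏ p ∈ m.primeFactors, p = m :=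
  Nat.prod_primeFactors_of_squarefree hm.squarefree

theorem totient_eq_prod (hm : IsLehmer m) : m.totient = ∏ p ∈ m.primeFactors, (p - 1) := by
  have h := Nat.totient_mul_prod_primeFactors m
  rw [hm.prod_primeFactors, mul_comm] at h
  exact Nat.eq_of_mul_eq_mul_left (by have := hm.1; omega) h

theorem exists_eq_totient_mul (hm : IsLehmer m) : ∃ K, 2 ≤ K ∧ m = m.totient * K + 1 := by
  obtain ⟨K, hK⟩ := hm.2.2
  have h1 := hm.1
  refine ⟨K, ?_, by omega⟩
  by_contra h
  have : K = 0 ∨ K = 1 := by omega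
  rcases this with rfl | rfl
  · omega
  · rw [mul_one] at hK
    exact hm.2.1 ((Nat.totient_eq_iff_prime (by omega)).1 hK.symm)

theorem odd_of_mem_primeFactors (hm : IsLehmer m) {p : ℕ} (hp : p ∈ m.primeFactors) : Odd p :=
  hm.odd.of_dvd_nat (Nat.dvd_of_mem_primeFactors hp)

theorem lt_two_pow_two_pow (hm : IsLehmer m) : m < 2 ^ 2 ^ m.primeFactors.card := by
  obtain ⟨K, hK2, hK⟩ := hm.exists_eq_totient_mul
  set s := m.primeFactors with hs
  -- `x` lists the prime factors in increasing order; the bound is then used with `a = 1`, `b = K`.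
  set x : ℕ → ℕ := Nat.nth (· ∈ s) with hx
  have hfin : (Set.ofPred (· ∈ s)).Finite := s.finite_toSet
  have hfs : hfin.toFinset = s := by ext; simp
  have hmem : ∀ i < s.card, x i ∈ s := fun i hi =>
    Nat.nth_mem_of_lt_card hfin (by rwa [hfs])
  have hlt : ∀ i j, i < j → j < s.card → x i < x j := fun i j hij hj =>
    Nat.nth_lt_nth_of_lt_card hfin hij (by rwa [hfs])
  have hinj : Set.InjOn x (Finset.range s.card : Set ℕ) := by
    have := Nat.nth_injOn hfin
    rw [hfs] at this
    simpa using this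
  have himg : (Finset.range s.card).image x = s := by
    refine Finset.eq_of_subset_of_card_le (fun p hp => ?_) ?_
    · obtain ⟨i, hi, rfl⟩ := Finset.mem_image.1 hp
      exact hmem i (Finset.mem_range.1 hi)
    · rw [Finset.card_image_of_injOn hinj, Finset.card_range]
  have hprod : ∀ f : ℕ → ℕ, ∏ i ∈ Finset.range s.card, f (x i) = ∏ p ∈ s, f p := fun f => by
    conv_rhs => rw [← himg]
    rw [Finset.prod_image hinj]
  have h2 : ∀ i < s.card, 2 ≤ x i := fun i hi => (Nat.prime_of_mem_primeFactors (hmem i hi)).two_le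
  have hPall : ∏ i ∈ Finset.range s.card, x i = m := by
    rw [hprod fun p => p, hm.prod_primeFactors]
  have hQall : ∏ i ∈ Finset.range s.card, (x i - 1) = m.totient := by
    rw [hprod fun p => p - 1, hm.totient_eq_prod]
  have hcard : 0 < s.card := Finset.card_pos.2 (Nat.nonempty_primeFactors.2 hm.1)
  have h := mul_prod_lt_pow_two_pow s.card x 1 K hcard one_pos h2
    (fun i hi => (hlt i (i + 1) (by omega) hi).le) (fun j hj => ?_) ?_
  · simpa [hPall] using h
  · obtain ⟨t, ht⟩ := Nat.exists_eq_add_of_lt hj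
    rw [add_assoc] at ht
    rw [ht, Finset.prod_range_add] at hPall hQall
    set F := ∏ i ∈ Finset.range j, x i
    set f := ∏ i ∈ Finset.range j, (x i - 1)
    set H := ∏ i ∈ Finset.range (t + 1), x (j + i)
    set e := ∏ i ∈ Finset.range (t + 1), (x (j + i) - 1)
    have heH : e + 1 ≤ H := by
      refine Nat.succ_le_of_lt (Finset.prod_lt_prod_of_nonempty (fun i hi => ?_) (fun i hi => ?_)
        (by simp))
      · have := h2 (j + i) (by have := Finset.mem_range.1 hi; omega)
        omega
      · have := h2 (j + i) (by have := Finset.mem_range.1 hi; omega)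
        omega
    have hF : 0 < F := Finset.prod_pos fun i hi => by
      have := h2 i (by have := Finset.mem_range.1 hi; omega)
      omega
    rw [one_mul]
    -- If `K f ≤ F`, then `F (e + 1) ≤ F H = f e K + 1 ≤ F e + 1` forces `F = 1`, hence `K ≤ 1`.
    by_contra hcon
    push Not at hcon
    have h5 : f * e * K + 1 = F * H := by rw [hPall, hQall]; omega
    have h6 : f * e * K ≤ F * e := by
      calc f * e * K = (K * f) * e := by ring
        _ ≤ F * e := Nat.mul_le_mul_right _ hcon
    have h7 : F * (e + 1) ≤ F * H := Nat.mul_le_mul_left _ heH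
    have h8 : F = 1 := by
      rw [mul_add] at h7
      omega
    have h9 : 0 < f := Finset.prod_pos fun i hi => by
      have := h2 i (by have := Finset.mem_range.1 hi; omega)
      omega
    have : K ≤ K * f := Nat.le_mul_of_pos_right _ h9
    omega
  · rw [hPall, hQall, one_mul, mul_comm]
    omega

theorem two_pow_card_primeFactors_dvd (hm : IsLehmer m) : 2 ^ m.primeFactors.card ∣ m - 1 := by
  refine Dvd.dvd.trans ?_ hm.2.2
  rw [hm.totient_eq_prod, ← Finset.prod_const]
  refine Finset.prod_dvd_prod_of_dvd _ _ fun p hp => ?_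
  have h1 := hm.odd_of_mem_primeFactors hp
  rw [Nat.odd_iff] at h1
  omega

end IsLehmer

/-! ### Repunits and the bound on the base. -/

theorem repunit_eq_sum {g : ℕ} (hg : 2 ≤ g) (n : ℕ) :
    repunit g n = ∑ i ∈ Finset.range n, g ^ i :=
  (Nat.geomSum_eq hg n).symm

theorem repunit_succ {g : ℕ} (hg : 2 ≤ g) (n : ℕ) : repunit g (n + 1) = g * repunit g n + 1 := by
  rw [repunit_eq_sum hg, repunit_eq_sum hg, Finset.sum_range_succ', Finset.mul_sum]
  simp [pow_succ, mul_comm]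

theorem sub_one_mul_repunit (g n : ℕ) : (g - 1) * repunit g n = g ^ n - 1 :=
  Nat.mul_div_cancel' (by simpa using Nat.sub_dvd_pow_sub_pow g 1 n)

theorem two_le_of_isLehmer_repunit {g n : ℕ} (hg : 2 ≤ g) (hm : IsLehmer (repunit g n)) :
    2 ≤ n := by
  by_contra h
  have h1 := hm.1
  rw [repunit_eq_sum hg] at h1
  have : n = 0 ∨ n = 1 := by omega
  rcases this with rfl | rfl <;> simp at h1

theorem pow_lt_repunit_succ {g n : ℕ} (hg : 2 ≤ g) (hn : 1 ≤ n) : g ^ n < repunit g (n + 1) := by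
  rw [repunit_eq_sum hg, Finset.sum_range_succ]
  have : 0 < ∑ i ∈ Finset.range n, g ^ i :=
    Finset.sum_pos (fun i _ => by positivity) (by simpa using (by omega : n ≠ 0))
  omega

theorem odd_of_isLehmer_repunit {g n : ℕ} (hg : 2 ≤ g) (hodd : Odd g)
    (hm : IsLehmer (repunit g n)) : Odd n := by
  have h := hm.odd
  rw [repunit_eq_sum hg, Finset.odd_sum_iff_odd_card_odd] at h
  simpa [hodd.pow] using h

/-- With `t = n - 1` even, `2^k` divides `m - 1 = g * repunit g t`, and lifting the exponent
evaluates `ν₂(g^t - 1)`. The `+ 1` is the one from that formula. -/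
theorem card_primeFactors_add_one_le {g n : ℕ} (hg : 2 ≤ g) (hodd : Odd g)
    (hm : IsLehmer (repunit g n)) :
    (repunit g n).primeFactors.card + 1 ≤ padicValNat 2 (g + 1) + padicValNat 2 (n - 1) := by
  have hn := two_le_of_isLehmer_repunit hg hm
  have hnodd := odd_of_isLehmer_repunit hg hodd hm
  have hdvd := hm.two_pow_card_primeFactors_dvd
  set k := (repunit g n).primeFactors.card
  obtain ⟨t, rfl⟩ := Nat.exists_eq_add_of_le' (by omega : 1 ≤ n)
  rw [repunit_succ hg, Nat.add_sub_cancel] at hdvd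
  rw [Nat.add_sub_cancel]
  have h1 : 2 ^ k ∣ repunit g t :=
    (Nat.Coprime.pow_left k (Nat.coprime_two_left.2 hodd)).dvd_of_dvd_mul_left hdvd
  have hteven : Even t := by
    rw [Nat.even_iff]
    rw [Nat.odd_iff] at hnodd
    omega
  rw [Nat.odd_iff] at hodd
  have h2 := padicValNat.pow_two_sub_pow (x := g) (y := 1) (by omega) (by omega) (by omega)
    (n := t) (by omega) hteven
  rw [one_pow, ← sub_one_mul_repunit] at h2
  have h3 : repunit g t ≠ 0 := by
    intro h0
    have := sub_one_mul_repunit g t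
    rw [h0, mul_zero] at this
    have : 1 < g ^ t := Nat.one_lt_pow (by omega) (by omega)
    omega
  rw [padicValNat.mul (by omega) h3] at h2
  have h4 : k ≤ padicValNat 2 (repunit g t) := (padicValNat_dvd_iff_le h3).1 h1
  omega

theorem base_lt_of_isLehmer_repunit {L : ℝ} {g n : ℕ} (hg : 2 ≤ g)
    (h1 : 1 ≤ padicValNat 2 (g + 1)) (hL : (padicValNat 2 (g + 1) : ℝ) ≤ L)
    (hm : IsLehmer (repunit g n)) : (g : ℝ) < (2 : ℝ) ^ ((2 : ℝ) ^ (L - 1)) := by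
  have hodd : Odd g := by
    have := dvd_of_one_le_padicValNat h1
    rw [Nat.odd_iff]
    omega
  have hn := two_le_of_isLehmer_repunit hg hm
  have hk := card_primeFactors_add_one_le hg hodd hm
  have hlt := hm.lt_two_pow_two_pow
  set k := (repunit g n).primeFactors.card
  obtain ⟨t, rfl⟩ := Nat.exists_eq_add_of_le' (by omega : 1 ≤ n)
  rw [Nat.add_sub_cancel] at hk
  set v := padicValNat 2 (g + 1)
  have h2 : (2 : ℕ) ^ k ≤ 2 ^ (v - 1) * t := by
    calc 2 ^ k ≤ 2 ^ (v - 1 + padicValNat 2 t) := Nat.pow_le_pow_right (by norm_num) (by omega)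
      _ = 2 ^ (v - 1) * 2 ^ padicValNat 2 t := pow_add _ _ _
      _ ≤ _ := Nat.mul_le_mul_left _ (Nat.le_of_dvd (by omega) pow_padicValNat_dvd)
  have h3 : g ^ t < (2 ^ 2 ^ (v - 1)) ^ t := by
    rw [← pow_mul]
    exact ((pow_lt_repunit_succ hg (by omega)).trans hlt).trans_le
      (Nat.pow_le_pow_right (by norm_num) h2)
  have h4 : g < 2 ^ 2 ^ (v - 1) := lt_of_pow_lt_pow_left₀ t (by positivity) h3
  calc (g : ℝ) < ((2 ^ 2 ^ (v - 1) : ℕ) : ℝ) := by exact_mod_cast h4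
    _ = (2 : ℝ) ^ ((2 : ℝ) ^ ((v : ℝ) - 1)) := by
        push_cast
        rw [← Real.rpow_natCast 2 (2 ^ (v - 1))]
        push_cast
        rw [← Real.rpow_natCast 2 (v - 1), Nat.cast_sub h1, Nat.cast_one]
    _ ≤ _ := by gcongr <;> norm_num

/-! ### Orders of `g` modulo the prime factors. -/

/-- The prime divisors `p` of `m` for which the order of `g` modulo `p` is divisible by `q`. -/
noncomputable def primesWithOrderDvd (g m q : ℕ) : Finset ℕ :=
  {p ∈ m.primeFactors | q ∣ orderOf (g : ZMod p)}

section

variable {g n : ℕ}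

theorem pow_eq_one_of_dvd_repunit (hg : 2 ≤ g) {p : ℕ} (hp : p ∣ repunit g n) :
    (g : ZMod p) ^ n = 1 := by
  have h : p ∣ g ^ n - 1 := (sub_one_mul_repunit g n) ▸ hp.mul_left _
  have h1 : ((g ^ n - 1 : ℕ) : ZMod p) = 0 := (ZMod.natCast_eq_zero_iff _ _).2 h
  rw [Nat.cast_sub (Nat.one_le_pow _ _ (by omega))] at h1
  simpa [sub_eq_zero] using h1

theorem orderOf_dvd_sub_one {p : ℕ} (hp : p.Prime) (hpm : p ∣ repunit g n) (hg : 2 ≤ g)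
    (hn : n ≠ 0) : orderOf (g : ZMod p) ∣ p - 1 := by
  have := Fact.mk hp
  refine orderOf_dvd_of_pow_eq_one (ZMod.pow_card_sub_one_eq_one fun h => ?_)
  have := pow_eq_one_of_dvd_repunit hg hpm
  rw [h, zero_pow hn] at this
  exact zero_ne_one this

theorem orderOf_dvd_of_dvd_repunit (hg : 2 ≤ g) {p : ℕ} (hp : p ∣ repunit g n) :
    orderOf (g : ZMod p) ∣ n :=
  orderOf_dvd_of_pow_eq_one (pow_eq_one_of_dvd_repunit hg hp)

theorem repunit_cast_of_orderOf_eq_one (hg : 2 ≤ g) {p : ℕ} (h : orderOf (g : ZMod p) = 1)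
    (n : ℕ) : ((repunit g n : ℕ) : ZMod p) = n := by
  rw [orderOf_eq_one_iff] at h
  rw [repunit_eq_sum hg]
  push_cast
  simp [h]

theorem repunit_dvd_repunit (hg : 2 ≤ g) {d : ℕ} (h : d ∣ n) : repunit g d ∣ repunit g n := by
  obtain ⟨e, rfl⟩ := h
  refine Nat.dvd_of_mul_dvd_mul_left (by omega : 0 < g - 1) ?_
  rw [sub_one_mul_repunit, sub_one_mul_repunit, pow_mul]
  simpa using Nat.sub_dvd_pow_sub_pow (g ^ d) 1 e

theorem sub_one_dvd_totient {m p : ℕ} (hp : p.Prime) (h : p ∣ m) : p - 1 ∣ m.totient := by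
  rw [← Nat.totient_prime hp]
  exact Nat.totient_dvd_of_dvd h

/-- A repunit with the Lehmer property is coprime to its length. -/
theorem not_dvd_of_dvd_repunit (hg : 2 ≤ g) (hm : IsLehmer (repunit g n)) {p : ℕ}
    (hp : p.Prime) (hpm : p ∣ repunit g n) : ¬ p ∣ n := by
  intro hpn
  have hR := repunit_dvd_repunit hg hpn
  have hlt : p < repunit g p := by
    obtain ⟨t, rfl⟩ := Nat.exists_eq_add_of_le' hp.one_lt.le
    have h1 := pow_lt_repunit_succ hg (n := t) (by have := hp.one_lt; omega)
    have h2 : t < g ^ t := Nat.lt_pow_self (by omega)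
    omega
  -- The order of `g` modulo `r` is 1 or `p`. In the second case `p ∣ r - 1 ∣ φ(m)`, impossible as
  -- `p ∣ m`. So the squarefree `repunit g p` would be at most `p`.
  have hall : ∀ r, r.Prime → r ∣ repunit g p → r = p := by
    intro r hr hrp
    have hord := orderOf_dvd_of_dvd_repunit hg hrp
    rcases (Nat.dvd_prime hp).1 hord with h | h
    · have h1 := repunit_cast_of_orderOf_eq_one hg h p
      rw [(ZMod.natCast_eq_zero_iff _ _).2 hrp] at h1
      exact (Nat.prime_dvd_prime_iff_eq hr hp).1 ((ZMod.natCast_eq_zero_iff _ _).1 h1.symm)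
    · have h1 : p ∣ r - 1 := h ▸ orderOf_dvd_sub_one hr hrp hg hp.ne_zero
      have h2 := h1.trans (sub_one_dvd_totient hr (hrp.trans hR))
      exact absurd (hm.eq_one_of_dvd_of_dvd_totient hpm h2) hp.one_lt.ne'
  have hsq : Squarefree (repunit g p) := hm.squarefree.squarefree_of_dvd hR
  have h1 : (repunit g p).primeFactors ⊆ {p} := fun r hr => by
    rw [Finset.mem_singleton]
    exact hall r (Nat.prime_of_mem_primeFactors hr) (Nat.dvd_of_mem_primeFactors hr)
  have h2 : repunit g p ≤ p := by
    rw [← Nat.prod_primeFactors_of_squarefree hsq]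
    calc ∏ r ∈ (repunit g p).primeFactors, r ≤ ∏ r ∈ {p}, r :=
          Finset.prod_le_prod_of_subset_of_one_le' h1 fun r hr _ => by
            rw [Finset.mem_singleton.1 hr]
            exact hp.one_lt.le
      _ = p := Finset.prod_singleton _ _
  omega

theorem orderOf_ne_one (hg : 2 ≤ g) (hm : IsLehmer (repunit g n)) {p : ℕ}
    (hp : p.Prime) (hpm : p ∣ repunit g n) : orderOf (g : ZMod p) ≠ 1 := by
  intro h
  have h1 := repunit_cast_of_orderOf_eq_one hg h n
  rw [(ZMod.natCast_eq_zero_iff _ _).2 hpm] at h1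
  exact not_dvd_of_dvd_repunit hg hm hp hpm ((ZMod.natCast_eq_zero_iff _ _).1 h1.symm)

/-- Take a prime factor of `Φ_d(g)`. The exceptional case of Zsigmondy's theorem cannot occur, since
that prime divides the repunit and hence not `n`. -/
theorem exists_prime_orderOf_eq (hg : 2 ≤ g) (hm : IsLehmer (repunit g n)) {d : ℕ}
    (hd1 : d ≠ 1) (hd : d ∣ n) :
    ∃ p ∈ (repunit g n).primeFactors, orderOf (g : ZMod p) = d := by
  have hn : n ≠ 0 := by have := two_le_of_isLehmer_repunit hg hm; omega
  have hd0 : d ≠ 0 := fun h => hn (Nat.eq_zero_of_zero_dvd (h ▸ hd))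
  have hlt := Polynomial.sub_one_lt_natAbs_cyclotomic_eval (n := d) (q := g) (by omega) (by omega)
  set Φ := Polynomial.eval (g : ℤ) (Polynomial.cyclotomic d ℤ) with hΦ
  obtain ⟨p, hp, hpd⟩ := Nat.exists_prime_and_dvd (n := Φ.natAbs) (by omega)
  have := Fact.mk hp
  have hpΦ : (p : ℤ) ∣ Φ := Int.natCast_dvd.2 hpd
  have hΦm : Φ ∣ (repunit g n : ℤ) := by
    have h1 : Polynomial.cyclotomic d ℤ ∣ ∑ i ∈ Finset.range n, Polynomial.X ^ i := by
      rw [← Polynomial.prod_cyclotomic_eq_geom_sum (Nat.pos_of_ne_zero hn)]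
      exact Finset.dvd_prod_of_mem _ (by simp [hd1, hd, hn])
    have h2 := Polynomial.eval_dvd (x := (g : ℤ)) h1
    rw [repunit_eq_sum hg]
    push_cast
    simpa [Polynomial.eval_finsetSum] using h2
  have hpm : p ∣ repunit g n := Int.natCast_dvd_natCast.1 (hpΦ.trans hΦm)
  have hpn := not_dvd_of_dvd_repunit hg hm hp hpm
  have : NeZero (d : ZMod p) := ⟨fun h => hpn (((ZMod.natCast_eq_zero_iff _ _).1 h).trans hd)⟩
  refine ⟨p, Nat.mem_primeFactors.2 ⟨hp, hpm, by have := hm.1; omega⟩, ?_⟩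
  refine (Polynomial.isRoot_cyclotomic_iff.1 (?_ : (Polynomial.cyclotomic d (ZMod p)).IsRoot _)).eq_orderOf.symm
  rw [Polynomial.IsRoot, ← Polynomial.map_cyclotomic d (Int.castRingHom (ZMod p)), ← Int.cast_natCast g,
    ← eq_intCast (Int.castRingHom (ZMod p)), Polynomial.eval_map_apply, eq_intCast]
  exact (ZMod.intCast_zmod_eq_zero_iff_dvd _ _).2 hpΦ

theorem dvd_sub_one_of_mem (hg : 2 ≤ g) (hm : IsLehmer (repunit g n)) {p q : ℕ}
    (hp : p ∈ primesWithOrderDvd g (repunit g n) q) : q ∣ p - 1 := by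
  obtain ⟨h1, h2⟩ := Finset.mem_filter.1 hp
  have hn : n ≠ 0 := by have := two_le_of_isLehmer_repunit hg hm; omega
  exact h2.trans (orderOf_dvd_sub_one (Nat.prime_of_mem_primeFactors h1)
    (Nat.dvd_of_mem_primeFactors h1) hg hn)

theorem pow_card_primesWithOrderDvd_dvd (hg : 2 ≤ g) (hm : IsLehmer (repunit g n)) (q : ℕ) :
    q ^ (primesWithOrderDvd g (repunit g n) q).card ∣ (repunit g n).totient := by
  rw [hm.totient_eq_prod, ← Finset.prod_const]
  exact (Finset.prod_dvd_prod_of_dvd _ _ fun p hp => dvd_sub_one_of_mem hg hm hp).trans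
    (Finset.prod_dvd_prod_of_subset _ _ _ (Finset.filter_subset _ _))

/-- With `G = g^(q-1) ≡ 1` modulo `q`, the quotient `(G^t - 1)/(G - 1) ≡ t` is prime to `q`. -/
theorem pow_dvd_pow_sub_one_of_not_dvd {q t a : ℕ} (hq : q.Prime) (hg : 2 ≤ g) (hqg : ¬ q ∣ g)
    (hqt : ¬ q ∣ t) (h : q ^ a ∣ g ^ t - 1) : q ^ a ∣ g ^ (q - 1) - 1 := by
  have := Fact.mk hq
  rcases Nat.eq_or_lt_of_le hq.two_le with h2 | h2
  · subst h2
    rw [pow_one]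
    rw [← sub_one_mul_repunit] at h
    have hco : Nat.Coprime 2 (repunit g t) := by
      rw [hq.coprime_iff_not_dvd, repunit_eq_sum hg, ← even_iff_two_dvd,
        Nat.not_even_iff_odd, Finset.odd_sum_iff_odd_card_odd]
      have hgo : Odd g := by rw [Nat.odd_iff]; omega
      simp only [hgo.pow, Finset.filter_true, Finset.card_range]
      rw [Nat.odd_iff]
      omega
    exact (Nat.Coprime.pow_left a hco).dvd_of_dvd_mul_right h
  · set G := g ^ (q - 1) with hG
    have hG2 : 2 ≤ G := by
      calc 2 ≤ g := hg
        _ = g ^ 1 := (pow_one g).symm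
        _ ≤ _ := Nat.pow_le_pow_right (by omega) (by omega)
    have h3 : q ^ a ∣ G ^ t - 1 := by
      refine h.trans ?_
      rw [hG, ← pow_mul, mul_comm, pow_mul]
      simpa using Nat.sub_dvd_pow_sub_pow (g ^ t) 1 (q - 1)
    rw [← sub_one_mul_repunit] at h3
    have hG1 : (G : ZMod q) = 1 := by
      rw [hG]
      push_cast
      exact ZMod.pow_card_sub_one_eq_one fun h0 => hqg ((ZMod.natCast_eq_zero_iff _ _).1 h0)
    have hco : Nat.Coprime q (repunit G t) := by
      rw [hq.coprime_iff_not_dvd, ← ZMod.natCast_eq_zero_iff,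
        repunit_cast_of_orderOf_eq_one hG2 (orderOf_eq_one_iff.2 hG1), ZMod.natCast_eq_zero_iff]
      exact hqt
    exact (Nat.Coprime.pow_left a hco).dvd_of_dvd_mul_right h3

/-- Each such prime is 1 modulo `q`, so `q` to their number divides `m - 1`. As `q ∤ n - 1`, the
power of `q` in `m - 1` is at most `g^q`. -/
theorem card_primesWithOrderDvd_le (hg : 2 ≤ g) (hm : IsLehmer (repunit g n)) {q : ℕ}
    (hq : q.Prime) (hqn : q ∣ n) : (primesWithOrderDvd g (repunit g n) q).card ≤ g * q := by
  have hn := two_le_of_isLehmer_repunit hg hm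
  have h := (pow_card_primesWithOrderDvd_dvd hg hm q).trans hm.2.2
  set a := (primesWithOrderDvd g (repunit g n) q).card
  obtain ⟨t, rfl⟩ := Nat.exists_eq_add_of_le' (by omega : 1 ≤ n)
  rw [repunit_succ hg, Nat.add_sub_cancel] at h
  have hqt : ¬ q ∣ t := fun h' => hq.one_lt.ne' (Nat.dvd_one.1 ((Nat.dvd_add_right h').1 hqn))
  have hle : q ^ a ≤ g ^ q := by
    by_cases hqg : q ∣ g
    · have hco : Nat.Coprime q (repunit g t) := by
        obtain ⟨s, rfl⟩ := Nat.exists_eq_add_of_le' (by omega : 1 ≤ t)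
        rw [repunit_succ hg, hq.coprime_iff_not_dvd]
        exact fun h' => hq.one_lt.ne' (Nat.dvd_one.1
          ((Nat.dvd_add_right (hqg.mul_right _)).1 h'))
      have h1 := (Nat.Coprime.pow_left a hco).dvd_of_dvd_mul_right h
      exact (Nat.le_of_dvd (by omega) h1).trans (Nat.le_self_pow hq.ne_zero g)
    · have hco : Nat.Coprime (q ^ a) g :=
        Nat.Coprime.pow_left a ((hq.coprime_iff_not_dvd).2 hqg)
      have h1 : q ^ a ∣ g ^ t - 1 := by
        rw [← sub_one_mul_repunit]
        exact (hco.dvd_of_dvd_mul_left h).mul_left _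
      have h2 := pow_dvd_pow_sub_one_of_not_dvd hq hg hqg hqt h1
      have h3 : 1 < g ^ (q - 1) := Nat.one_lt_pow (by have := hq.two_le; omega) (by omega)
      have h4 := Nat.le_of_dvd (by omega) h2
      have h5 : g ^ (q - 1) ≤ g ^ q := Nat.pow_le_pow_right (by omega) (by omega)
      omega
  have h6 : 2 ^ a ≤ 2 ^ (g * q) := by
    calc 2 ^ a ≤ q ^ a := Nat.pow_le_pow_left hq.two_le a
      _ ≤ g ^ q := hle
      _ ≤ (2 ^ g) ^ q := Nat.pow_le_pow_left (Nat.lt_two_pow_self).le q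
      _ = _ := (pow_mul _ _ _).symm
  exact (Nat.pow_le_pow_iff_right (by norm_num)).1 h6

theorem two_pow_card_primeFactors_le_card_divisors {n : ℕ} (hn : n ≠ 0) :
    2 ^ n.primeFactors.card ≤ n.divisors.card := by
  rw [Nat.card_divisors hn]
  refine Finset.pow_card_le_prod _ _ _ fun p hp => ?_
  have := (Nat.prime_of_mem_primeFactors hp).factorization_pos_of_dvd hn
    (Nat.dvd_of_mem_primeFactors hp)
  omega

/-- Distinct divisors `d` of `n/q` give distinct primes of order `q d`, so `n/q` has at most `g q`
divisors. -/
theorem two_pow_card_primeFactors_le (hg : 2 ≤ g) (hm : IsLehmer (repunit g n)) {q : ℕ}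
    (hq : q.Prime) (hqn : q ∣ n) : 2 ^ n.primeFactors.card ≤ 2 * (g * q) := by
  have hn : n ≠ 0 := by have := two_le_of_isLehmer_repunit hg hm; omega
  obtain ⟨e, rfl⟩ := hqn
  have he : e ≠ 0 := right_ne_zero_of_mul hn
  have h1 : (q * e).primeFactors.card ≤ e.primeFactors.card + 1 := by
    rw [Nat.primeFactors_mul hq.ne_zero he, hq.primeFactors, Finset.union_comm]
    exact Finset.card_union_le _ _
  have h2 : e.divisors.card ≤ (primesWithOrderDvd g (repunit g (q * e)) q).card := by
    have hex : ∀ d ∈ e.divisors, ∃ p ∈ (repunit g (q * e)).primeFactors,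
        orderOf (g : ZMod p) = q * d := fun d hd =>
      exists_prime_orderOf_eq hg hm (fun h => hq.one_lt.ne' (Nat.eq_one_of_mul_eq_one_right h))
        (Nat.mul_dvd_mul_left q (Nat.dvd_of_mem_divisors hd))
    choose! f hf1 hf2 using hex
    refine Finset.card_le_card_of_injOn f (fun d hd => ?_) (fun d hd d' hd' h => ?_)
    · exact Finset.mem_coe.2 (Finset.mem_filter.2 ⟨hf1 d hd, hf2 d hd ▸ Dvd.intro _ rfl⟩)
    · have h3 := hf2 d hd
      rw [h, hf2 d' hd'] at h3
      exact (Nat.eq_of_mul_eq_mul_left hq.pos h3).symm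
  calc 2 ^ (q * e).primeFactors.card ≤ 2 ^ (e.primeFactors.card + 1) :=
        Nat.pow_le_pow_right (by norm_num) h1
    _ = 2 * 2 ^ e.primeFactors.card := by ring
    _ ≤ 2 * (g * q) := Nat.mul_le_mul_left _
        ((two_pow_card_primeFactors_le_card_divisors he).trans
          (h2.trans (card_primesWithOrderDvd_le hg hm hq (Dvd.intro _ rfl))))

end

/-! ### Separation of short products from the integers. -/

/-- The values `p/(p-1)` together with their limit 1 form a compact set, and so do products of such
sets. Each element is 1 or an odd number over an even one, so none is an integer `≥ 2`. -/
theorem exists_compact_prod_div_sub_one (r : ℕ) : ∃ C : Set ℝ, IsCompact C ∧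
    (∀ x ∈ C, ∃ a b : ℕ, Odd a ∧ b ≠ 0 ∧ x = a / b ∧ (a = 1 ∧ b = 1 ∨ Even b)) ∧
    ∀ S : Finset ℕ, (∀ p ∈ S, Odd p ∧ p ≠ 1) → S.card ≤ r →
      ∏ p ∈ S, ((p : ℝ) / (p - 1)) ∈ C := by
  induction r with
  | zero =>
    refine ⟨{1}, isCompact_singleton, fun x hx => ⟨1, 1, odd_one, one_ne_zero, ?_, Or.inl ⟨rfl, rfl⟩⟩,
      fun S _ hS => ?_⟩
    · simpa using hx
    · simp [Finset.card_eq_zero.1 (Nat.le_zero.1 hS)]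
  | succ r ih =>
    obtain ⟨C, hC, hfrac, hprod⟩ := ih
    set f : ℕ → ℝ := fun j => ((2 * j + 3 : ℕ) : ℝ) / ((2 * j + 2 : ℕ) : ℝ) with hf
    have hlim : Filter.Tendsto f Filter.atTop (nhds 1) := by
      have h1 : Filter.Tendsto (fun j : ℕ => 1 + (1 / 2) * (1 / ((j : ℝ) + 1))) Filter.atTop
          (nhds (1 + (1 / 2) * 0)) :=
        tendsto_const_nhds.add (tendsto_one_div_add_atTop_nhds_zero_nat.const_mul _)
      rw [mul_zero, add_zero] at h1
      refine h1.congr fun j => ?_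
      rw [hf]
      push_cast
      have : (j : ℝ) + 1 ≠ 0 := by positivity
      have : 2 * (j : ℝ) + 2 ≠ 0 := by positivity
      field_simp
      ring
    refine ⟨(fun z : ℝ × ℝ => z.1 * z.2) '' (C ×ˢ insert 1 (Set.range f)),
      (hC.prod hlim.isCompact_insert_range).image continuous_mul, ?_, ?_⟩
    · rintro _ ⟨⟨x, y⟩, ⟨hx, rfl | ⟨j, rfl⟩⟩, rfl⟩
      · simpa using hfrac x hx
      · obtain ⟨a, b, ha, hb, rfl, -⟩ := hfrac x hx
        refine ⟨a * (2 * j + 3), b * (2 * j + 2), ha.mul ⟨j + 1, by ring⟩,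
          mul_ne_zero hb (by omega), ?_, Or.inr (Even.mul_left ⟨j + 1, by ring⟩ b)⟩
        simp only [hf]
        push_cast
        rw [div_mul_div_comm]
    · intro S hS hcard
      rcases S.eq_empty_or_nonempty with rfl | ⟨p, hp⟩
      · exact ⟨(1, 1), ⟨by simpa using hprod ∅ (by simp) (by simp), Set.mem_insert _ _⟩, by simp⟩
      · refine ⟨(∏ p ∈ S.erase p, ((p : ℝ) / (p - 1)), (p : ℝ) / (p - 1)),
          ⟨hprod _ (fun r hr => hS r (Finset.mem_of_mem_erase hr)) ?_, Or.inr ?_⟩,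
          Finset.prod_erase_mul _ _ hp⟩
        · rw [Finset.card_erase_of_mem hp]
          omega
        · obtain ⟨⟨j, rfl⟩, h1⟩ := hS p hp
          obtain ⟨i, rfl⟩ := Nat.exists_eq_add_of_le' (by omega : 1 ≤ j)
          refine ⟨i, ?_⟩
          simp only [hf]
          push_cast
          congr 1 <;> ring

/-- Products of at most `r` factors `p / (p - 1)` with odd `p` stay away from the integers `≥ 2`. -/
theorem exists_pos_le_abs_prod_div_sub_one_sub (r : ℕ) : ∃ ε : ℝ, 0 < ε ∧
    ∀ S : Finset ℕ, (∀ p ∈ S, Odd p ∧ p ≠ 1) → S.card ≤ r → ∀ K : ℕ, 2 ≤ K →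
      ε ≤ |∏ p ∈ S, ((p : ℝ) / (p - 1)) - K| := by
  obtain ⟨C, hC, hfrac, hprod⟩ := exists_compact_prod_div_sub_one r
  have hZ : IsClosed (((↑) : ℕ → ℝ) '' {K | 2 ≤ K}) :=
    Nat.isClosedEmbedding_coe_real.isClosedMap _ (isClosed_discrete _)
  have hdisj : Disjoint C (((↑) : ℕ → ℝ) '' {K | 2 ≤ K}) := by
    rw [Set.disjoint_left]
    rintro x hx ⟨K, hK, rfl⟩
    obtain ⟨a, b, ha, hb, hab, h⟩ := hfrac _ hx
    rw [eq_div_iff (by exact_mod_cast hb)] at hab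
    have hab' : K * b = a := by exact_mod_cast hab
    rcases h with ⟨rfl, rfl⟩ | h
    · have : 2 ≤ K := hK
      omega
    · rw [← hab', ← Nat.not_even_iff_odd] at ha
      exact ha (h.mul_left K)
  obtain ⟨ε, hε, hd⟩ := hdisj.exists_thickenings hC hZ
  refine ⟨ε, hε, fun S hS hcard K hK => ?_⟩
  by_contra hcon
  push Not at hcon
  rw [← Real.dist_eq] at hcon
  exact Set.disjoint_left.1 hd (Metric.self_subset_thickening hε _ (hprod S hS hcard))
    (Metric.mem_thickening_iff.2 ⟨K, ⟨K, hK, rfl⟩, hcon⟩)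

/-! ### Estimates for reciprocal sums. -/

/-- The largest of `s + 1` positive integers is at least `s + 1`, and `1/(s+1) ≤ 2√(s+1) - 2√s`
telescopes. -/
theorem sum_one_div_le_two_mul_sqrt_card (J : Finset ℕ) (hJ : ∀ j ∈ J, 0 < j) :
    ∑ j ∈ J, (1 : ℝ) / j ≤ 2 * √J.card := by
  induction J using Finset.induction_on_max with
  | empty => simp
  | insert a s ha ih =>
    have hnot : a ∉ s := fun h => lt_irrefl _ (ha a h)
    rw [Finset.sum_insert hnot, Finset.card_insert_of_notMem hnot]
    have h1 := ih fun j hj => hJ j (Finset.mem_insert_of_mem hj)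
    have hcard : s.card + 1 ≤ a := by
      have hsub : s ⊆ Finset.Ioo 0 a := fun j hj =>
        Finset.mem_Ioo.2 ⟨hJ j (Finset.mem_insert_of_mem hj), ha j hj⟩
      have h2 := Finset.card_le_card hsub
      rw [Nat.card_Ioo] at h2
      have := hJ a (Finset.mem_insert_self _ _)
      omega
    have h3 : (1 : ℝ) / a ≤ 1 / (s.card + 1) := by
      have : (s.card : ℝ) + 1 ≤ a := by exact_mod_cast hcard
      gcongr
    push_cast
    set u := √(s.card : ℝ) with hu
    set v := √((s.card : ℝ) + 1) with hv
    have hu2 : u ^ 2 = s.card := Real.sq_sqrt (by positivity)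
    have hv2 : v ^ 2 = s.card + 1 := Real.sq_sqrt (by positivity)
    have hv0 : 0 < v := by positivity
    have huv : 1 / ((s.card : ℝ) + 1) ≤ 2 * v - 2 * u := by
      rw [← hv2, div_le_iff₀ (by positivity)]
      have hu0 : 0 ≤ u := Real.sqrt_nonneg _
      have huv' : u ≤ v := Real.sqrt_le_sqrt (by linarith)
      have hv1 : 1 ≤ v := by
        rw [hv]
        exact Real.one_le_sqrt.2 (by linarith [(Nat.cast_nonneg s.card : (0 : ℝ) ≤ _)])
      have h5 : (v - u) * (v + u) = 1 := by linarith [mul_self_nonneg u, (by ring : (v - u) * (v + u) = v ^ 2 - u ^ 2)]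
      have h6 : (v - u) * (v + u) ≤ (v - u) * (2 * v ^ 2) :=
        mul_le_mul_of_nonneg_left (by nlinarith) (by linarith)
      linarith
    linarith

theorem sum_one_div_sub_one_le {A : Finset ℕ} {q : ℕ} (hq : 0 < q) (hA : ∀ p ∈ A, 2 ≤ p ∧ q ∣ p - 1) :
    ∑ p ∈ A, (1 : ℝ) / (p - 1) ≤ 2 * √A.card / q := by
  have hmul : ∀ p ∈ A, q * ((p - 1) / q) = p - 1 := fun p hp => Nat.mul_div_cancel' (hA p hp).2
  have hinj : Set.InjOn (fun p => (p - 1) / q) (A : Set ℕ) := fun p hp p' hp' h => by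
    have h1 := hmul p hp
    have h2 := hmul p' hp'
    have h3 := (hA p hp).1
    have h4 := (hA p' hp').1
    have h5 : (p - 1) / q = (p' - 1) / q := h
    rw [h5] at h1
    omega
  have h := sum_one_div_le_two_mul_sqrt_card (A.image fun p => (p - 1) / q) fun j hj => by
    obtain ⟨p, hp, rfl⟩ := Finset.mem_image.1 hj
    have h1 := (hA p hp).1
    have h2 := hmul p hp
    refine Nat.pos_of_ne_zero fun h0 => ?_
    rw [h0] at h2
    omega
  rw [Finset.sum_image hinj, Finset.card_image_of_injOn hinj] at h
  have hq' : (0 : ℝ) < q := by exact_mod_cast hq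
  rw [le_div_iff₀ hq', Finset.sum_mul]
  refine le_trans (Finset.sum_le_sum fun p hp => ?_) h
  have h1 : ((p : ℝ) - 1) = q * ((p - 1) / q : ℕ) := by
    rw [← Nat.cast_mul, hmul p hp, Nat.cast_sub (by have := (hA p hp).1; omega), Nat.cast_one]
  rw [h1, one_div, mul_inv, mul_comm, ← mul_assoc, mul_inv_cancel₀ hq'.ne', one_mul, one_div]

theorem sum_biUnion_le_sum_sum {ι α : Type*} [DecidableEq α] (s : Finset ι) (t : ι → Finset α)
    (f : α → ℝ) (hf : ∀ i ∈ s, ∀ a ∈ t i, 0 ≤ f a) :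
    ∑ a ∈ s.biUnion t, f a ≤ ∑ i ∈ s, ∑ a ∈ t i, f a := by
  classical
  induction s using Finset.induction_on with
  | empty => simp
  | insert i s hi ih =>
    rw [Finset.biUnion_insert, Finset.sum_insert hi]
    have h1 := ih fun j hj => hf j (Finset.mem_insert_of_mem hj)
    have h2 : 0 ≤ ∑ a ∈ t i ∩ s.biUnion t, f a := Finset.sum_nonneg fun a ha =>
      hf i (Finset.mem_insert_self _ _) a (Finset.mem_inter.1 ha).1
    have h3 := Finset.sum_union_inter (s₁ := t i) (s₂ := s.biUnion t) (f := f)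
    linarith

theorem tendsto_log_div_sqrt_atTop {c : ℝ} (hc : 0 < c) :
    Filter.Tendsto (fun q : ℕ => Real.log (c * q) / √(q : ℝ)) Filter.atTop (nhds 0) := by
  have h1 : Filter.Tendsto (fun x : ℝ => Real.log x / √x) Filter.atTop (nhds 0) := by
    have := (isLittleO_log_rpow_atTop (r := 1 / 2) (by norm_num)).tendsto_div_nhds_zero
    simpa [Real.sqrt_eq_rpow] using this
  have h2 : Filter.Tendsto (fun q : ℕ => c * (q : ℝ)) Filter.atTop Filter.atTop :=
    tendsto_natCast_atTop_atTop.const_mul_atTop hc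
  have h3 := (h1.comp h2).const_mul √c
  rw [mul_zero] at h3
  refine h3.congr fun q => ?_
  have : √c ≠ 0 := by positivity
  simp only [Function.comp]
  rw [Real.sqrt_mul hc.le, mul_div_assoc', mul_div_mul_left _ _ this]

/-! ### Finiteness for a fixed base. -/

section

variable {g : ℕ}

/-- Each `q' ≥ q` contributes at most `2√(g q')/q' ≤ 2√g/√q`, and `n` has at most `log₂ (2 g q)`
prime factors. The bound tends to 0 as `q` grows. -/
theorem sum_one_div_le_of_forall_exists_dvd (hg : 2 ≤ g) {n : ℕ} (hm : IsLehmer (repunit g n))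
    {q : ℕ} (hq : q.Prime) (hqn : q ∣ n) {T : Finset ℕ}
    (hT : ∀ p ∈ T, ∃ q' ∈ n.primeFactors, q ≤ q' ∧ p ∈ primesWithOrderDvd g (repunit g n) q') :
    ∑ p ∈ T, (1 : ℝ) / (p - 1) ≤
      Real.log (2 * g * q) / √(q : ℝ) * (2 * √(g : ℝ) / Real.log 2) := by
  set I := n.primeFactors.filter (q ≤ ·)
  have hnn : ∀ p : ℕ, p ∈ (repunit g n).primeFactors → 0 ≤ (1 : ℝ) / (p - 1) := fun p hp => by
    have : (1 : ℝ) ≤ p := by exact_mod_cast (Nat.prime_of_mem_primeFactors hp).one_lt.le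
    exact one_div_nonneg.2 (by linarith)
  have hmem : ∀ {q' p : ℕ}, p ∈ primesWithOrderDvd g (repunit g n) q' →
      p ∈ (repunit g n).primeFactors := fun h => (Finset.mem_filter.1 h).1
  have hq0 : (0 : ℝ) < q := by exact_mod_cast hq.pos
  have hterm : ∀ q' ∈ I, ∑ p ∈ primesWithOrderDvd g (repunit g n) q', (1 : ℝ) / (p - 1) ≤
      2 * √(g : ℝ) / √(q : ℝ) := fun q' hq' => by
    obtain ⟨h1, h2⟩ := Finset.mem_filter.1 hq'
    have hp' := Nat.prime_of_mem_primeFactors h1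
    have h3 := sum_one_div_sub_one_le (A := primesWithOrderDvd g (repunit g n) q') hp'.pos
      fun p hp => ⟨(Nat.prime_of_mem_primeFactors (hmem hp)).two_le, dvd_sub_one_of_mem hg hm hp⟩
    refine h3.trans ?_
    have h4 := card_primesWithOrderDvd_le hg hm hp' (Nat.dvd_of_mem_primeFactors h1)
    have hq'0 : (0 : ℝ) < q' := by exact_mod_cast hp'.pos
    calc 2 * √((primesWithOrderDvd g (repunit g n) q').card : ℝ) / q'
        ≤ 2 * √((g : ℝ) * q') / q' := by
          gcongr
          exact_mod_cast h4
      _ = 2 * √(g : ℝ) / √(q' : ℝ) := by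
          rw [Real.sqrt_mul (by positivity)]
          have h5 : √(q' : ℝ) * √(q' : ℝ) = q' := Real.mul_self_sqrt hq'0.le
          have h6 : √(q' : ℝ) ≠ 0 := by positivity
          rw [div_eq_div_iff hq'0.ne' h6]
          linear_combination 2 * √(g : ℝ) * h5
      _ ≤ 2 * √(g : ℝ) / √(q : ℝ) := by
          gcongr
  have hcard : (I.card : ℝ) ≤ Real.log (2 * g * q) / Real.log 2 := by
    rw [le_div_iff₀ (Real.log_pos one_lt_two), ← Real.log_pow]
    refine Real.log_le_log (by positivity) ?_
    have h1 : 2 ^ I.card ≤ 2 * g * q := by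
      rw [mul_assoc]
      exact (Nat.pow_le_pow_right (by norm_num) (Finset.card_le_card (Finset.filter_subset _ _))).trans
        (two_pow_card_primeFactors_le hg hm hq hqn)
    exact_mod_cast h1
  calc ∑ p ∈ T, (1 : ℝ) / (p - 1)
      ≤ ∑ p ∈ I.biUnion (primesWithOrderDvd g (repunit g n)), (1 : ℝ) / (p - 1) := by
        refine Finset.sum_le_sum_of_subset_of_nonneg (fun p hp => ?_) fun p hp _ => ?_
        · obtain ⟨q', h1, h2, h3⟩ := hT p hp
          exact Finset.mem_biUnion.2 ⟨q', Finset.mem_filter.2 ⟨h1, h2⟩, h3⟩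
        · obtain ⟨q', -, h⟩ := Finset.mem_biUnion.1 hp
          exact hnn p (hmem h)
    _ ≤ ∑ q' ∈ I, ∑ p ∈ primesWithOrderDvd g (repunit g n) q', (1 : ℝ) / (p - 1) :=
        sum_biUnion_le_sum_sum _ _ _ fun q' _ p hp => hnn p (hmem hp)
    _ ≤ ∑ q' ∈ I, 2 * √(g : ℝ) / √(q : ℝ) := Finset.sum_le_sum hterm
    _ = I.card * (2 * √(g : ℝ) / √(q : ℝ)) := by rw [Finset.sum_const, nsmul_eq_mul]
    _ ≤ Real.log (2 * g * q) / Real.log 2 * (2 * √(g : ℝ) / √(q : ℝ)) := by gcongr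
    _ = _ := by ring

theorem card_filter_exists_prime_le (hg : 2 ≤ g) {n : ℕ} (hm : IsLehmer (repunit g n)) (B : ℕ) :
    ((repunit g n).primeFactors.filter fun p =>
      ∃ q ∈ n.primeFactors, q ≤ B ∧ q ∣ orderOf (g : ZMod p)).card ≤
      ∑ q ∈ Finset.range (B + 1), g * q := by
  calc _ ≤ ((n.primeFactors.filter (· ≤ B)).biUnion (primesWithOrderDvd g (repunit g n))).card := by
        refine Finset.card_le_card fun p hp => ?_
        obtain ⟨hp, q, hq, hqB, hqo⟩ := Finset.mem_filter.1 hp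
        exact Finset.mem_biUnion.2 ⟨q, Finset.mem_filter.2 ⟨hq, hqB⟩, Finset.mem_filter.2 ⟨hp, hqo⟩⟩
    _ ≤ ∑ q ∈ n.primeFactors.filter (· ≤ B), g * q :=
        Finset.card_biUnion_le.trans (Finset.sum_le_sum fun q hq => by
          have hq := (Finset.mem_filter.1 hq).1
          exact card_primesWithOrderDvd_le hg hm (Nat.prime_of_mem_primeFactors hq)
            (Nat.dvd_of_mem_primeFactors hq))
    _ ≤ _ := Finset.sum_le_sum_of_subset fun q hq =>
        Finset.mem_range.2 (Nat.lt_succ_of_le (Finset.mem_filter.1 hq).2)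

/-- The primes dividing the length of a Lehmer repunit cannot have arbitrarily large gaps. -/
theorem exists_forall_primeFactors_le_or (hg : 2 ≤ g) (B : ℕ) : ∃ B' : ℕ, ∀ n : ℕ,
    IsLehmer (repunit g n) → (∀ q ∈ n.primeFactors, q ≤ B) ∨
      ∃ q ∈ n.primeFactors, B < q ∧ q ≤ B' := by
  set r := ∑ q ∈ Finset.range (B + 1), g * q with hr
  obtain ⟨ε, hε, hsep⟩ := exists_pos_le_abs_prod_div_sub_one_sub r
  set η : ℕ → ℝ := fun q => Real.log (2 * g * q) / √(q : ℝ) * (2 * √(g : ℝ) / Real.log 2) with hη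
  have hg0 : (0 : ℝ) < g := by exact_mod_cast (by omega : 0 < g)
  -- The two terms will bound `1/φ(m)` and `x (y - 1)`, where `m/φ(m) = x y` is split over `S` and
  -- its complement `T`.
  have hlim : Filter.Tendsto (fun q : ℕ => 1 / (q : ℝ) + 2 ^ r * (Real.exp (η q) - 1))
      Filter.atTop (nhds 0) := by
    have h1 : Filter.Tendsto η Filter.atTop (nhds 0) := by
      simpa using (tendsto_log_div_sqrt_atTop (by positivity : (0 : ℝ) < 2 * g)).mul_const
        (2 * √(g : ℝ) / Real.log 2)
    have h2 := (((Real.continuous_exp.tendsto 0).comp h1).sub_const 1).const_mul ((2 : ℝ) ^ r)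
    simpa using tendsto_one_div_atTop_nhds_zero_nat.add h2
  obtain ⟨B', hB'⟩ := Filter.eventually_atTop.1 (hlim.eventually (gt_mem_nhds hε))
  refine ⟨B', fun n hm => ?_⟩
  by_contra hcon
  push Not at hcon
  obtain ⟨⟨q₀, hq₀, hq₀B⟩, hgap⟩ := hcon
  obtain ⟨q, hqI, hqmin⟩ := Finset.exists_min_image (n.primeFactors.filter (B < ·)) id
    ⟨q₀, Finset.mem_filter.2 ⟨hq₀, hq₀B⟩⟩
  obtain ⟨hqn, hqB⟩ := Finset.mem_filter.1 hqI
  have hqp := Nat.prime_of_mem_primeFactors hqn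
  have hqd := Nat.dvd_of_mem_primeFactors hqn
  have hlt := hB' q (hgap q hqn hqB).le
  obtain ⟨K, hK2, hK⟩ := hm.exists_eq_totient_mul
  set m := repunit g n with hmdef
  set S := m.primeFactors.filter fun p =>
    ∃ q ∈ n.primeFactors, q ≤ B ∧ q ∣ orderOf (g : ZMod p)
  have hSsub : S ⊆ m.primeFactors := Finset.filter_subset _ _
  have hScard : S.card ≤ r := card_filter_exists_prime_le hg hm B
  set T := m.primeFactors \ S with hT
  have hTsum : ∑ p ∈ T, (1 : ℝ) / (p - 1) ≤ η q := by
    -- For `p ∉ S`, every prime factor of the order exceeds `B`, hence is at least `q` by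
    -- minimality.
    refine sum_one_div_le_of_forall_exists_dvd hg hm hqp hqd fun p hp => ?_
    obtain ⟨hp1, hp2⟩ := Finset.mem_sdiff.1 hp
    have hpp := Nat.prime_of_mem_primeFactors hp1
    have hpd := Nat.dvd_of_mem_primeFactors hp1
    obtain ⟨q', hq', hq'd⟩ := Nat.exists_prime_and_dvd (orderOf_ne_one hg hm hpp hpd)
    have hq'n : q' ∈ n.primeFactors := Nat.mem_primeFactors.2
      ⟨hq', hq'd.trans (orderOf_dvd_of_dvd_repunit hg hpd), (Nat.mem_primeFactors.1 hqn).2.2⟩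
    have hpA : p ∈ primesWithOrderDvd g m q' := Finset.mem_filter.2 ⟨hp1, hq'd⟩
    refine ⟨q', hq'n, ?_, hpA⟩
    by_contra hlt'
    refine hp2 (Finset.mem_filter.2 ⟨hp1, q', hq'n, ?_, hq'd⟩)
    by_contra hB
    exact hlt' (hqmin q' (Finset.mem_filter.2 ⟨hq'n, by omega⟩))
  have hpge : ∀ p ∈ m.primeFactors, (2 : ℝ) ≤ p := fun p hp => by
    exact_mod_cast (Nat.prime_of_mem_primeFactors hp).two_le
  set x := ∏ p ∈ S, ((p : ℝ) / (p - 1)) with hx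
  set y := ∏ p ∈ T, ((p : ℝ) / (p - 1)) with hy
  have hx0 : 0 ≤ x := Finset.prod_nonneg fun p hp => by
    have := hpge p (hSsub hp)
    exact div_nonneg (by linarith) (by linarith)
  have hx2 : x ≤ 2 ^ r := by
    calc x ≤ ∏ p ∈ S, (2 : ℝ) := Finset.prod_le_prod (fun p hp => by
            have := hpge p (hSsub hp)
            exact div_nonneg (by linarith) (by linarith)) fun p hp => by
            have := hpge p (hSsub hp)
            rw [div_le_iff₀ (by linarith)]
            linarith
      _ = 2 ^ S.card := Finset.prod_const _
      _ ≤ _ := pow_le_pow_right₀ one_le_two hScard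
  have hyeq : y = ∏ p ∈ T, (1 + (1 : ℝ) / (p - 1)) := Finset.prod_congr rfl fun p hp => by
    have := hpge p (Finset.mem_sdiff.1 hp).1
    have : (p : ℝ) - 1 ≠ 0 := by linarith
    field_simp
    ring
  have hynn : ∀ p ∈ T, 0 ≤ (1 : ℝ) / (p - 1) := fun p hp => by
    have := hpge p (Finset.mem_sdiff.1 hp).1
    exact one_div_nonneg.2 (by linarith)
  have hy1 : 1 ≤ y := by
    rw [hyeq]
    calc (1 : ℝ) = ∏ p ∈ T, 1 := by simp
      _ ≤ _ := Finset.prod_le_prod (fun _ _ => zero_le_one) fun p hp => by linarith [hynn p hp]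
  have hy2 : y ≤ Real.exp (η q) := by
    rw [hyeq]
    refine le_trans ?_ (Real.exp_le_exp.2 hTsum)
    rw [Real.exp_sum]
    refine Finset.prod_le_prod (fun p hp => by linarith [hynn p hp]) fun p _ => ?_
    linarith [Real.add_one_le_exp ((1 : ℝ) / (p - 1))]
  have hφ0 : 0 < m.totient := Nat.totient_pos.2 (by have := hm.1; omega)
  have hφ0' : (0 : ℝ) < m.totient := by exact_mod_cast hφ0
  have hxy : x * y = K + 1 / m.totient := by
    rw [hx, hy, mul_comm, Finset.prod_sdiff hSsub, Finset.prod_div_distrib, ← Nat.cast_prod,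
      hm.prod_primeFactors]
    have : ∏ p ∈ m.primeFactors, ((p : ℝ) - 1) = m.totient := by
      rw [hm.totient_eq_prod, Nat.cast_prod]
      refine Finset.prod_congr rfl fun p hp => ?_
      rw [Nat.cast_sub (Nat.prime_of_mem_primeFactors hp).one_lt.le, Nat.cast_one]
    rw [this, div_eq_iff hφ0'.ne', add_mul, one_div, inv_mul_cancel₀ hφ0'.ne', mul_comm]
    exact_mod_cast hK
  have hφq : q ≤ m.totient := by
    obtain ⟨p, hp, hpo⟩ := exists_prime_orderOf_eq hg hm hqp.one_lt.ne' hqd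
    have hpp := Nat.prime_of_mem_primeFactors hp
    have hpd := Nat.dvd_of_mem_primeFactors hp
    have h1 := orderOf_dvd_sub_one hpp hpd hg (Nat.mem_primeFactors.1 hqn).2.2
    rw [hpo] at h1
    exact Nat.le_of_dvd hφ0 (h1.trans (sub_one_dvd_totient hpp hpd))
  have hq0 : (0 : ℝ) < q := by exact_mod_cast hqp.pos
  have hφq' : 1 / (m.totient : ℝ) ≤ 1 / q := by
    have : (q : ℝ) ≤ m.totient := by exact_mod_cast hφq
    gcongr
  have hfin := hsep S (fun p hp => ⟨hm.odd_of_mem_primeFactors (hSsub hp),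
    (Nat.prime_of_mem_primeFactors (hSsub hp)).one_lt.ne'⟩) hScard K hK2
  have hxy1 : x * (y - 1) ≤ 2 ^ r * (Real.exp (η q) - 1) :=
    mul_le_mul hx2 (by linarith) (by linarith) (by positivity)
  have hxy0 : 0 ≤ x * (y - 1) := mul_nonneg hx0 (by linarith)
  have hinv : 0 ≤ 1 / (m.totient : ℝ) := by positivity
  have habs : |x - K| ≤ 1 / (q : ℝ) + 2 ^ r * (Real.exp (η q) - 1) := by
    rw [abs_le]
    constructor <;> linarith [mul_sub x y 1]
  linarith

/-- For every base `g ≥ 2`, the repunits with the Lehmer property are bounded. -/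
theorem exists_forall_isLehmer_repunit_le (hg : 2 ≤ g) :
    ∃ M : ℕ, ∀ n : ℕ, IsLehmer (repunit g n) → repunit g n ≤ M := by
  choose f hf using exists_forall_primeFactors_le_or hg
  set F : ℕ → ℕ := fun B => max B (f B)
  -- Each application of `F` either exhausts the prime factors of `n` or captures a new one.
  have hiter : ∀ j n, IsLehmer (repunit g n) → (∀ q ∈ n.primeFactors, q ≤ F^[j] 0) ∨
      j ≤ (n.primeFactors.filter (· ≤ F^[j] 0)).card := by
    intro j n hm
    induction j with
    | zero => exact Or.inr (Nat.zero_le _)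
    | succ j ih =>
      rw [Function.iterate_succ_apply']
      set B := F^[j] 0
      have hle : B ≤ F B := le_max_left _ _
      rcases ih with h | h
      · exact Or.inl fun q hq => (h q hq).trans hle
      rcases hf B n hm with h' | ⟨q, hq, hqB, hqf⟩
      · exact Or.inl fun q hq => (h' q hq).trans hle
      refine Or.inr ((Nat.succ_le_succ h).trans ?_)
      rw [Nat.succ_eq_add_one, ← Finset.card_insert_of_notMem
        (a := q) (s := n.primeFactors.filter (· ≤ B)) (by simp [hqB])]
      refine Finset.card_le_card (Finset.insert_subset
        (Finset.mem_filter.2 ⟨hq, hqf.trans (le_max_right _ _)⟩) fun q' hq' => ?_)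
      obtain ⟨h1, h2⟩ := Finset.mem_filter.1 hq'
      exact Finset.mem_filter.2 ⟨h1, h2.trans hle⟩
  set b := F^[1] 0
  -- Some prime factor of `n` is at most `b`, so `n` has fewer than `2 g b` of them; after that many
  -- applications of `F` all are captured.
  set B := F^[2 * (g * b)] 0
  refine ⟨2 ^ 2 ^ ∑ q ∈ Finset.range (B + 1), g * q, fun n hm => ?_⟩
  have hn := two_le_of_isLehmer_repunit hg hm
  obtain ⟨q, hq, hqb⟩ : ∃ q ∈ n.primeFactors, q ≤ b := by
    rcases hiter 1 n hm with h | h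
    · obtain ⟨q, hq⟩ := Nat.nonempty_primeFactors.2 hn
      exact ⟨q, hq, h q hq⟩
    · obtain ⟨q, hq⟩ := Finset.card_pos.1 h
      exact ⟨q, (Finset.mem_filter.1 hq).1, (Finset.mem_filter.1 hq).2⟩
  have hω : n.primeFactors.card < 2 * (g * b) :=
    calc n.primeFactors.card < 2 ^ n.primeFactors.card := Nat.lt_two_pow_self
      _ ≤ 2 * (g * q) := two_pow_card_primeFactors_le hg hm (Nat.prime_of_mem_primeFactors hq)
          (Nat.dvd_of_mem_primeFactors hq)
      _ ≤ 2 * (g * b) := by gcongr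
  have hall : ∀ q ∈ n.primeFactors, q ≤ B := by
    rcases hiter (2 * (g * b)) n hm with h | h
    · exact h
    · exact absurd (h.trans (Finset.card_le_card (Finset.filter_subset _ _))) (by omega)
  have hk : (repunit g n).primeFactors.card ≤ ∑ q ∈ Finset.range (B + 1), g * q := by
    refine le_trans (Finset.card_le_card fun p hp => ?_) (card_filter_exists_prime_le hg hm B)
    have hpp := Nat.prime_of_mem_primeFactors hp
    have hpd := Nat.dvd_of_mem_primeFactors hp
    obtain ⟨q', hq', hq'd⟩ := Nat.exists_prime_and_dvd (orderOf_ne_one hg hm hpp hpd)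
    have hq'n : q' ∈ n.primeFactors := Nat.mem_primeFactors.2
      ⟨hq', hq'd.trans (orderOf_dvd_of_dvd_repunit hg hpd), by omega⟩
    exact Finset.mem_filter.2 ⟨hp, q', hq'n, hall q' hq'n, hq'd⟩
  exact hm.lt_two_pow_two_pow.le.trans
    (Nat.pow_le_pow_right (by norm_num) (Nat.pow_le_pow_right (by norm_num) hk))

end

theorem theorem4 (L : ℝ) (hL : 1 ≤ L) :
    (∀ g n : ℕ, 2 ≤ g → 1 ≤ n →
      1 ≤ padicValNat 2 (g + 1) → (padicValNat 2 (g + 1) : ℝ) ≤ L →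
      IsLehmer (repunit g n) → (g : ℝ) < (2 : ℝ) ^ ((2 : ℝ) ^ (L - 1))) ∧
    {b : ℕ | b ∈ oddRepunits L ∧ IsLehmer b}.Finite := by
  refine ⟨fun g n hg _ h1 h2 hm => base_lt_of_isLehmer_repunit hg h1 h2 hm, ?_⟩
  obtain ⟨G, hG⟩ := exists_nat_gt ((2 : ℝ) ^ ((2 : ℝ) ^ (L - 1)))
  have hM : ∀ g : ℕ, ∃ M : ℕ, 2 ≤ g → ∀ n : ℕ, IsLehmer (repunit g n) → repunit g n ≤ M := by
    intro g
    by_cases hg : 2 ≤ g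
    · obtain ⟨M, hM⟩ := exists_forall_isLehmer_repunit_le hg
      exact ⟨M, fun _ => hM⟩
    · exact ⟨0, fun h => absurd h hg⟩
  choose M hM using hM
  refine ((Finset.range G).finite_toSet.biUnion fun g _ => Set.finite_Iic (M g)).subset ?_
  rintro _ ⟨⟨g, n, hg, -, h1, h2, rfl⟩, hm⟩
  have hgG : g < G := by exact_mod_cast (base_lt_of_isLehmer_repunit hg h1 h2 hm).trans hG
  exact Set.mem_biUnion (Finset.mem_coe.2 (Finset.mem_range.2 hgG)) (hM g hg n hm)
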